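/- Let formulas be built from a countably infinite set of propositional variables (among them three distinct ones $p,q,r$) by the binary connectives $\land,\lor,\to$ and the unary operators $\neg,\Box,\Box_L$, and let $\varphi\leftrightarrow\psi$ abbreviate $(\varphi\to\psi)\land(\psi\to\varphi)$. The axiom system $\mathsf{BM.C}$ has the axioms $p\to p$; $\neg(p\land q)\to(\neg p\lor\neg q)$; $(\neg p\land\neg q)\to\neg(p\lor q)$; $(p\land q)\to p$; $(p\land q)\to q$; $p\to(p\lor q)$; $q\to(p\lor q)$; $((p\to q)\land(p\to r))\to(p\to(q\land r))$; $((p\to r)\land(q\to r))\to((p\lor q)\to r)$; $(p\land(q\lor r))\to((p\land q)\lor(p\land r))$; $(\Box p\land\Box q)\to\Box(p\land q)$; $(\Box_L p\land\Box_L q)\to\Box_L(p\land q)$, and the rules Uniform Substitution (US), Modus Ponens (MP), (Adj) $\varphi,\psi\,/\,\varphi\land\psi$, (Aff) $\varphi'\to\varphi,\ \psi\to\psi'\,/\,(\varphi\to\psi)\to(\varphi'\to\psi')$, (Con) $\varphi\to\psi\,/\,\neg\psi\to\neg\varphi$, ($\Box$-Mon) $\varphi\to\psi\,/\,\Box\varphi\to\Box\psi$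 and ($\Box_L$-Mon) $\varphi\to\psi\,/\,\Box_L\varphi\to\Box_L\psi$. Let $\mathsf{L}$ be an axiom system obtained from $\mathsf{BM.C}$ by adding any selection of the axioms (DN) $p\leftrightarrow\neg\neg p$; (Cp) $(p\to q)\to(\neg q\to\neg p)$; (WB) $((p\to q)\land(q\to r))\to(p\to r)$; (X) $p\lor\neg p$; (Rd) $(p\to\neg p)\to\neg p$; (B) $(p\to q)\to((r\to p)\to(r\to q))$; (CB) $(p\to q)\to((q\to r)\to(p\to r))$; (W) $(p\to(p\to q))\to(p\to q)$; (C) $(p\to(q\to r))\to(q\to(p\to r))$; (M) $p\to(p\to p)$; ($\Box$K) $\Box(p\to q)\to(\Box p\to\Box q)$; ($\Box$T) $\Box p\to p$; ($\Box$D) $\Box\neg p\to\neg\Box p$; ($\Box$4) $\Box p\to\Box\Box p$; ($\Box$5) $\neg\Box p\to\Box\neg\Box p$ and of the rules (ER) $\varphi\,/\,(\varphi\to\psi)\to\psi$ and (Nec) $\varphi\,/\,\Box\varphi$. Let $\mathsf{CL}$ be the axiom system that consists of: a standard axiomatization of classical propositional logic in $\land,\lor,\to,\neg$, with (MP) and with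 (US) for substitutions of arbitrary formulas of the full language; the axiom $\Box_L\varphi$ for each axiom $\varphi$ of $\mathsf{L}$; the rule $\Box_L\varphi_1,\dots,\Box_L\varphi_n\,/\,\Box_L\psi$ for each inference rule $\varphi_1,\dots,\varphi_n\,/\,\psi$ of $\mathsf{L}$; and the Bridge Rule $\Box_L(\varphi\to\psi)\,/\,\varphi\to\psi$. Suppose that (Nec) is not an inference rule of $\mathsf{L}$. Then, for every formula $\varphi$: (i) if $\vdash_{\mathsf{L}}\varphi$, then $\vdash_{\mathsf{CL}}\varphi$; (ii) if $\vdash_{\mathsf{CL}}\Box_L\varphi$, then $\vdash_{\mathsf{CL}}\varphi$. -/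

import Mathlib

/-- Formulas of the bimodal language: propositional variables indexed by `ℕ`, the binary operators
`∧`, `∨`, `→`, and the unary operators `¬`, `□` (belief) and `□_L` (auxiliary). -/
inductive Fm : Type
  | var : ℕ → Fm
  | and : Fm → Fm → Fm
  | or : Fm → Fm → Fm
  | imp : Fm → Fm → Fm
  | neg : Fm → Fm
  | box : Fm → Fm
  | boxL : Fm → Fm

infixl:70 " ∧ₘ " => Fm.and
infixl:68 " ∨ₘ " => Fm.or
infixr:60 " →ₘ " => Fm.imp
prefix:80 "¬ₘ" => Fm.neg
prefix:80 "□ₘ" => Fm.box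
prefix:80 "□ₗ" => Fm.boxL

namespace Fm

/-- `φ ↔ ψ` abbreviates `(φ → ψ) ∧ (ψ → φ)`. -/
def iff (φ ψ : Fm) : Fm := (φ →ₘ ψ) ∧ₘ (ψ →ₘ φ)

/-- Uniform substitution of arbitrary formulas for propositional variables. -/
def subst (σ : ℕ → Fm) : Fm → Fm
  | var n => σ n
  | and φ ψ => subst σ φ ∧ₘ subst σ ψ
  | or φ ψ => subst σ φ ∨ₘ subst σ ψ
  | imp φ ψ => subst σ φ →ₘ subst σ ψ
  | neg φ => ¬ₘ(subst σ φ)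
  | box φ => □ₘ(subst σ φ)
  | boxL φ => □ₗ(subst σ φ)

/- The three distinct variables used to write axioms. -/
def p : Fm := var 0
def q : Fm := var 1
def r : Fm := var 2

end Fm

/-- An inference rule, given by the set of its instances
(list of premises, conclusion). -/
abbrev Rule : Type := Set (List Fm × Fm)

/-- A Hilbert-style axiom system: a set of axioms and a set of inference rules. -/
structure AxiomSystem where
  axioms : Set Fm
  rules : Set Rule

/-- `A.Provable φ`: the formula `φ` is a theorem of the axiom system `A`. -/
inductive AxiomSystem.Provable (A : AxiomSystem) : Fm → Prop
  | ax {φ : Fm} : φ ∈ A.axioms → A.Provable φ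
  | rule {ρ : Rule} {Γ : List Fm} {φ : Fm} :
      ρ ∈ A.rules → (Γ, φ) ∈ ρ → (∀ ψ ∈ Γ, A.Provable ψ) → A.Provable φ

namespace Rule

/-- Uniform substitution. -/
def us : Rule := {i | ∃ (σ : ℕ → Fm) (φ : Fm), i = ([φ], φ.subst σ)}

/-- Modus ponens. -/
def mp : Rule := {i | ∃ φ ψ : Fm, i = ([φ →ₘ ψ, φ], ψ)}

/-- Adjunction. -/
def adj : Rule := {i | ∃ φ ψ : Fm, i = ([φ, ψ], φ ∧ₘ ψ)}

/-- Affixing. -/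
def aff : Rule :=
  {i | ∃ φ φ' ψ ψ' : Fm, i = ([φ' →ₘ φ, ψ →ₘ ψ'], (φ →ₘ ψ) →ₘ (φ' →ₘ ψ'))}

/-- Contraposition. -/
def con : Rule := {i | ∃ φ ψ : Fm, i = ([φ →ₘ ψ], ¬ₘψ →ₘ ¬ₘφ)}

/-- Monotonicity of `□`. -/
def boxMon : Rule := {i | ∃ φ ψ : Fm, i = ([φ →ₘ ψ], □ₘφ →ₘ □ₘψ)}

/-- Monotonicity of `□_L`. -/
def boxLMon : Rule := {i | ∃ φ ψ : Fm, i = ([φ →ₘ ψ], □ₗφ →ₘ □ₗψ)}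

/-- The rule (ER): from `φ` infer `(φ → ψ) → ψ`. -/
def er : Rule := {i | ∃ φ ψ : Fm, i = ([φ], (φ →ₘ ψ) →ₘ ψ)}

/-- The necessitation rule (Nec): from `φ` infer `□φ`. -/
def nec : Rule := {i | ∃ φ : Fm, i = ([φ], □ₘφ)}

/-- The Bridge Rule (BR): from `□_L (φ → ψ)` infer `φ → ψ`. -/
def bridge : Rule := {i | ∃ φ ψ : Fm, i = ([□ₗ(φ →ₘ ψ)], φ →ₘ ψ)}

/-- The `□_L`-version of a rule: `□_L` is put in front of all premises and of the conclusion. -/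
def boxLVersion (ρ : Rule) : Rule :=
  {i | ∃ (Γ : List Fm) (φ : Fm), (Γ, φ) ∈ ρ ∧ i = (Γ.map Fm.boxL, □ₗφ)}

end Rule

open Fm in
/-- The axiom system `BM.C`. -/
def systemBMC : AxiomSystem where
  axioms :=
    { p →ₘ p,
      ¬ₘ(p ∧ₘ q) →ₘ (¬ₘp ∨ₘ ¬ₘq),
      (¬ₘp ∧ₘ ¬ₘq) →ₘ ¬ₘ(p ∨ₘ q),
      (p ∧ₘ q) →ₘ p,
      (p ∧ₘ q) →ₘ q,
      p →ₘ (p ∨ₘ q),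
      q →ₘ (p ∨ₘ q),
      ((p →ₘ q) ∧ₘ (p →ₘ r)) →ₘ (p →ₘ (q ∧ₘ r)),
      ((p →ₘ r) ∧ₘ (q →ₘ r)) →ₘ ((p ∨ₘ q) →ₘ r),
      (p ∧ₘ (q ∨ₘ r)) →ₘ ((p ∧ₘ q) ∨ₘ (p ∧ₘ r)),
      (□ₘp ∧ₘ □ₘq) →ₘ □ₘ(p ∧ₘ q),
      (□ₗp ∧ₘ □ₗq) →ₘ □ₗ(p ∧ₘ q) }
  rules :=
    {Rule.us, Rule.mp, Rule.adj, Rule.aff, Rule.con, Rule.boxLMon, Rule.boxMon}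

/-- Names of the additional postulates (frame conditions with their corresponding axioms or rules)
by which the relevant modal logics extend `BM.C`. -/
inductive Postulate : Type
  | DN | Cp | WB | X | Rd | B | CB | W | C | M | ER | Nec
  | boxK | boxT | boxD | box4 | box5

namespace Postulate

open Fm in
/-- The axioms corresponding to a postulate (none for the two rules). -/
def axioms : Postulate → Set Fm
  | DN => {Fm.iff p (¬ₘ¬ₘp)}
  | Cp => {(p →ₘ q) →ₘ (¬ₘq →ₘ ¬ₘp)}
  | WB => {((p →ₘ q) ∧ₘ (q →ₘ r)) →ₘ (p →ₘ r)}
  | X => {p ∨ₘ ¬ₘp}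
  | Rd => {(p →ₘ ¬ₘp) →ₘ ¬ₘp}
  | B => {(p →ₘ q) →ₘ ((r →ₘ p) →ₘ (r →ₘ q))}
  | CB => {(p →ₘ q) →ₘ ((q →ₘ r) →ₘ (p →ₘ r))}
  | W => {(p →ₘ (p →ₘ q)) →ₘ (p →ₘ q)}
  | C => {(p →ₘ (q →ₘ r)) →ₘ (q →ₘ (p →ₘ r))}
  | M => {p →ₘ (p →ₘ p)}
  | ER => ∅
  | Nec => ∅
  | boxK => {□ₘ(p →ₘ q) →ₘ (□ₘp →ₘ □ₘq)}
  | boxT => {□ₘp →ₘ p}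
  | boxD => {□ₘ¬ₘp →ₘ ¬ₘ□ₘp}
  | box4 => {□ₘp →ₘ □ₘ□ₘp}
  | box5 => {¬ₘ□ₘp →ₘ □ₘ¬ₘ□ₘp}

/-- The inference rules corresponding to a postulate (none for those that are axioms). -/
def rules : Postulate → Set Rule
  | ER => {Rule.er}
  | Nec => {Rule.nec}
  | _ => ∅

end Postulate

/-- The axiom system `L` of the relevant modal logic given by a selection `Λ` of postulates:
`BM.C` plus the axioms and rules corresponding to the members of `Λ`. -/
def relevantSystem (Λ : Set Postulate) : AxiomSystem where
  axioms := systemBMC.axioms ∪ ⋃ c ∈ Λ, c.axioms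
  rules := systemBMC.rules ∪ ⋃ c ∈ Λ, c.rules

open Fm in
/-- Axioms of the classical propositional calculus `CPC` (with (MP) and (US)) over the
connectives `∧`, `∨`, `→`, `¬`. -/
def axiomsCPC : Set Fm :=
  { p →ₘ (q →ₘ p),
    (p →ₘ (q →ₘ r)) →ₘ ((p →ₘ q) →ₘ (p →ₘ r)),
    (p ∧ₘ q) →ₘ p,
    (p ∧ₘ q) →ₘ q,
    p →ₘ (q →ₘ (p ∧ₘ q)),
    p →ₘ (p ∨ₘ q),
    q →ₘ (p ∨ₘ q),
    (p →ₘ r) →ₘ ((q →ₘ r) →ₘ ((p ∨ₘ q) →ₘ r)),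
    (p →ₘ q) →ₘ ((p →ₘ ¬ₘq) →ₘ ¬ₘp),
    ¬ₘ¬ₘp →ₘ p }

/-- The axiom system `CL` of the classical epistemic logic based on `L`: `CPC` with (MP) and (US)
for the full language, `□_L φ` for each axiom `φ` of `L`, the `□_L`-version of each inference rule
of `L`, and the Bridge Rule. -/
def classicalSystem (L : AxiomSystem) : AxiomSystem where
  axioms := axiomsCPC ∪ Fm.boxL '' L.axioms
  rules := {Rule.mp, Rule.us} ∪ Rule.boxLVersion '' L.rules ∪ {Rule.bridge}

/-! For (i), `L ⊢ φ` lifts to `CL ⊢ □ₗφ`, and the Bridge Rule removes `□ₗ` whenever `φ` is an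
implication. The other cases are the axioms (DN) and (X), which are classical, and the rules (US),
(MP), (Adj), which `CL` simulates. For (ii), it suffices that `CL ⊢ □ₗφ` gives `L ⊢ φ`; then (i)
applies. Under the valuation `Fm.Holds`, `□ₗφ` is true exactly when `L ⊢ φ`. `L` is sound for it
(`holds_subst_of_provable`), which validates the Bridge Rule and hence makes `CL` sound
(`holds_subst_of_classical_provable`). -/

namespace Fm

theorem subst_var (φ : Fm) : φ.subst var = φ := by
  induction φ <;> simp_all [subst]

theorem subst_subst (σ τ : ℕ → Fm) (φ : Fm) :
    (φ.subst σ).subst τ = φ.subst (fun n => (σ n).subst τ) := by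
  induction φ <;> simp_all [subst]

/-- Two-valued truth in which `□` is read as the identity and `□_L φ` as provability of `φ`
in `L`; propositional variables are false. -/
def Holds (L : AxiomSystem) : Fm → Prop
  | var _ => False
  | and φ ψ => Holds L φ ∧ Holds L ψ
  | or φ ψ => Holds L φ ∨ Holds L ψ
  | imp φ ψ => Holds L φ → Holds L ψ
  | neg φ => ¬ Holds L φ
  | box φ => Holds L φ
  | boxL φ => L.Provable φ

end Fm

namespace AxiomSystem

variable {A : AxiomSystem} {φ ψ : Fm}

theorem Provable.us (h : Rule.us ∈ A.rules) (σ : ℕ → Fm) (hφ : A.Provable φ) :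
    A.Provable (φ.subst σ) :=
  .rule h ⟨σ, φ, rfl⟩ (by simpa using hφ)

theorem Provable.mp (h : Rule.mp ∈ A.rules) (hi : A.Provable (φ →ₘ ψ)) (hφ : A.Provable φ) :
    A.Provable ψ :=
  .rule h ⟨φ, ψ, rfl⟩ (by simpa using ⟨hi, hφ⟩)

theorem Provable.adj (h : Rule.adj ∈ A.rules) (hφ : A.Provable φ) (hψ : A.Provable ψ) :
    A.Provable (φ ∧ₘ ψ) :=
  .rule h ⟨φ, ψ, rfl⟩ (by simpa using ⟨hφ, hψ⟩)

end AxiomSystem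

open AxiomSystem

/-! ### Soundness of `L` and `CL` for the provability valuation -/

section Relevant

variable {Λ : Set Postulate}

theorem systemBMC_rules_subset : systemBMC.rules ⊆ (relevantSystem Λ).rules :=
  Set.subset_union_left

theorem us_mem_relevantSystem : Rule.us ∈ (relevantSystem Λ).rules :=
  systemBMC_rules_subset (by simp [systemBMC])

theorem mp_mem_relevantSystem : Rule.mp ∈ (relevantSystem Λ).rules :=
  systemBMC_rules_subset (by simp [systemBMC])

theorem adj_mem_relevantSystem : Rule.adj ∈ (relevantSystem Λ).rules :=
  systemBMC_rules_subset (by simp [systemBMC])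

theorem mem_relevantSystem_rules {ρ : Rule} (h : ρ ∈ (relevantSystem Λ).rules) :
    ρ = Rule.us ∨ ρ = Rule.mp ∨ ρ = Rule.adj ∨ ρ = Rule.aff ∨ ρ = Rule.con ∨ ρ = Rule.boxLMon ∨
      ρ = Rule.boxMon ∨ ρ = Rule.er ∨ ρ = Rule.nec := by
  rcases h with h | h
  · simp only [systemBMC, Set.mem_insert_iff, Set.mem_singleton_iff] at h
    tauto
  · simp only [Set.mem_iUnion] at h
    obtain ⟨c, -, h⟩ := h
    cases c <;> simp_all [Postulate.rules]

theorem holds_subst_of_mem_axioms {φ : Fm} (h : φ ∈ (relevantSystem Λ).axioms) (σ : ℕ → Fm) :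
    (φ.subst σ).Holds (relevantSystem Λ) := by
  rcases h with h | h
  · simp only [systemBMC, Set.mem_insert_iff, Set.mem_singleton_iff] at h
    rcases h with rfl | rfl | rfl | rfl | rfl | rfl | rfl | rfl | rfl | rfl | rfl | rfl
    -- Aggregation for `□ₗ` is no tautology here: it says that `L` is closed under (Adj).
    case inr.inr.inr.inr.inr.inr.inr.inr.inr.inr.inr =>
      exact fun h => h.1.adj adj_mem_relevantSystem h.2
    all_goals
      simp only [Fm.subst, Fm.Holds, Fm.p, Fm.q, Fm.r]
      tauto
  · simp only [Set.mem_iUnion] at h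
    obtain ⟨c, -, h⟩ := h
    cases c <;> simp only [Postulate.axioms, Set.mem_singleton_iff, Set.mem_empty_iff_false] at h <;>
      subst h <;> simp only [Fm.subst, Fm.Holds, Fm.p, Fm.q, Fm.r, Fm.iff] <;> tauto

/-- Quantifying over all substitutions makes the induction pass through (US). -/
theorem holds_subst_of_provable {φ : Fm} (h : (relevantSystem Λ).Provable φ) :
    ∀ σ : ℕ → Fm, (φ.subst σ).Holds (relevantSystem Λ) := by
  induction h with
  | ax h => exact holds_subst_of_mem_axioms h
  | rule hρ hi hΓ ih =>
    intro σ
    rcases mem_relevantSystem_rules hρ with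
      rfl | rfl | rfl | rfl | rfl | rfl | rfl | rfl | rfl
    · obtain ⟨τ, φ, hi⟩ := hi
      cases hi
      rw [Fm.subst_subst]
      exact ih φ (by simp) _
    · obtain ⟨φ, ψ, hi⟩ := hi
      cases hi
      exact ih (φ →ₘ _) (by simp) σ (ih φ (by simp) σ)
    · obtain ⟨φ, ψ, hi⟩ := hi
      cases hi
      exact ⟨ih φ (by simp) σ, ih ψ (by simp) σ⟩
    · obtain ⟨φ, φ', ψ, ψ', hi⟩ := hi
      cases hi
      exact fun h h' => ih (ψ →ₘ ψ') (by simp) σ (h (ih (φ' →ₘ φ) (by simp) σ h'))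
    · obtain ⟨φ, ψ, hi⟩ := hi
      cases hi
      exact fun h h' => h (ih (φ →ₘ ψ) (by simp) σ h')
    · obtain ⟨φ, ψ, hi⟩ := hi
      cases hi
      -- Truth of the premise is not enough: its derivability, with (US) and (MP), turns a proof of
      -- the antecedent into one of the consequent.
      exact ((hΓ (φ →ₘ ψ) (by simp)).us us_mem_relevantSystem σ).mp mp_mem_relevantSystem
    · obtain ⟨φ, ψ, hi⟩ := hi
      cases hi
      exact ih (φ →ₘ ψ) (by simp) σ
    · obtain ⟨φ, ψ, hi⟩ := hi
      cases hi
      exact fun h => h (ih φ (by simp) σ)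
    · obtain ⟨φ, hi⟩ := hi
      cases hi
      exact ih φ (by simp) σ

theorem holds_subst_of_classical_provable {φ : Fm}
    (h : (classicalSystem (relevantSystem Λ)).Provable φ) :
    ∀ σ : ℕ → Fm, (φ.subst σ).Holds (relevantSystem Λ) := by
  induction h with
  | ax h =>
    intro σ
    rcases h with h | ⟨φ, h, rfl⟩
    · simp only [axiomsCPC, Set.mem_insert_iff, Set.mem_singleton_iff] at h
      rcases h with rfl | rfl | rfl | rfl | rfl | rfl | rfl | rfl | rfl | rfl <;>
        simp only [Fm.subst, Fm.Holds, Fm.p, Fm.q, Fm.r] <;> tauto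
    · exact (Provable.ax h).us us_mem_relevantSystem σ
  | rule hρ hi hΓ ih =>
    intro σ
    rcases hρ with ((rfl | rfl) | ⟨ρ, hρ, rfl⟩) | rfl
    · obtain ⟨φ, ψ, hi⟩ := hi
      cases hi
      exact ih (φ →ₘ _) (by simp) σ (ih φ (by simp) σ)
    · obtain ⟨τ, φ, hi⟩ := hi
      cases hi
      rw [Fm.subst_subst]
      exact ih φ (by simp) _
    · obtain ⟨Γ, φ, hi, he⟩ := hi
      cases he
      -- The identity substitution makes the premises theorems of `L`, and `σ` is applied only after
      -- the rule: instances of (US) itself are not closed under substitution.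
      refine (Provable.rule hρ hi fun ψ hψ => ?_).us us_mem_relevantSystem σ
      simpa [Fm.subst, Fm.Holds, Fm.subst_var] using
        ih (□ₗψ) (List.mem_map_of_mem hψ) Fm.var
    · obtain ⟨φ, ψ, hi⟩ := hi
      cases hi
      have h := ih (□ₗ(φ →ₘ ψ)) (by simp) σ
      -- `h` is derivability in `L`; soundness of `L` turns it into truth.
      have h' := holds_subst_of_provable (Λ := Λ) (φ := (φ →ₘ ψ).subst σ) h Fm.var
      rwa [Fm.subst_var] at h'

theorem provable_of_classical_provable_boxL {φ : Fm}
    (h : (classicalSystem (relevantSystem Λ)).Provable (□ₗφ)) :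
    (relevantSystem Λ).Provable φ := by
  simpa [Fm.subst, Fm.Holds, Fm.subst_var] using holds_subst_of_classical_provable h Fm.var

end Relevant

/-! ### Derivations inside `CL` -/

section Classical

variable {L : AxiomSystem} {φ ψ : Fm}

theorem mp_mem_classicalSystem : Rule.mp ∈ (classicalSystem L).rules :=
  .inl (.inl (by simp))

theorem us_mem_classicalSystem : Rule.us ∈ (classicalSystem L).rules :=
  .inl (.inl (by simp))

theorem classical_provable_boxL (h : L.Provable φ) :
    (classicalSystem L).Provable (□ₗφ) := by
  induction h with
  | ax h => exact .ax (.inr ⟨_, h, rfl⟩)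
  | rule hρ hi _ ih =>
    refine .rule (.inl (.inr ⟨_, hρ, rfl⟩)) ⟨_, _, hi, rfl⟩ fun χ hχ => ?_
    obtain ⟨ψ, hψ, rfl⟩ := List.mem_map.1 hχ
    exact ih ψ hψ

/-- The Bridge Rule transfers implications only, so other theorems of `L` need classical arguments.
-/
theorem classical_provable_imp (h : L.Provable (φ →ₘ ψ)) :
    (classicalSystem L).Provable (φ →ₘ ψ) :=
  .rule (.inr rfl) ⟨φ, ψ, rfl⟩ (by simpa using classical_provable_boxL h)

theorem classical_provable_of_mem_axiomsCPC (h : φ ∈ axiomsCPC) (σ : ℕ → Fm) :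
    (classicalSystem L).Provable (φ.subst σ) :=
  (Provable.ax (A := classicalSystem L) (Set.mem_union_left _ h)).us us_mem_classicalSystem σ

theorem classical_mp (hi : (classicalSystem L).Provable (φ →ₘ ψ))
    (h : (classicalSystem L).Provable φ) : (classicalSystem L).Provable ψ :=
  hi.mp mp_mem_classicalSystem h

/-- The substitution of three given formulas for `p`, `q`, `r`. -/
def substPQR (φ ψ χ : Fm) : ℕ → Fm
  | 0 => φ
  | 1 => ψ
  | _ => χ

theorem classical_k (φ ψ : Fm) : (classicalSystem L).Provable (φ →ₘ (ψ →ₘ φ)) :=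
  classical_provable_of_mem_axiomsCPC (φ := Fm.p →ₘ (Fm.q →ₘ Fm.p)) (by simp [axiomsCPC])
    (substPQR φ ψ φ)

theorem classical_s (φ ψ χ : Fm) : (classicalSystem L).Provable
    ((φ →ₘ (ψ →ₘ χ)) →ₘ ((φ →ₘ ψ) →ₘ (φ →ₘ χ))) :=
  classical_provable_of_mem_axiomsCPC
    (φ := (Fm.p →ₘ (Fm.q →ₘ Fm.r)) →ₘ ((Fm.p →ₘ Fm.q) →ₘ (Fm.p →ₘ Fm.r)))
    (by simp [axiomsCPC]) (substPQR φ ψ χ)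

theorem classical_and (hφ : (classicalSystem L).Provable φ)
    (hψ : (classicalSystem L).Provable ψ) : (classicalSystem L).Provable (φ ∧ₘ ψ) :=
  classical_mp (classical_mp (classical_provable_of_mem_axiomsCPC
    (φ := Fm.p →ₘ (Fm.q →ₘ (Fm.p ∧ₘ Fm.q))) (by simp [axiomsCPC]) (substPQR φ ψ φ)) hφ) hψ

theorem classical_or_left (φ ψ : Fm) : (classicalSystem L).Provable (φ →ₘ (φ ∨ₘ ψ)) :=
  classical_provable_of_mem_axiomsCPC (φ := Fm.p →ₘ (Fm.p ∨ₘ Fm.q))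
    (by simp [axiomsCPC]) (substPQR φ ψ φ)

theorem classical_or_right (φ ψ : Fm) : (classicalSystem L).Provable (ψ →ₘ (φ ∨ₘ ψ)) :=
  classical_provable_of_mem_axiomsCPC (φ := Fm.q →ₘ (Fm.p ∨ₘ Fm.q))
    (by simp [axiomsCPC]) (substPQR φ ψ φ)

theorem classical_neg_intro (φ ψ : Fm) : (classicalSystem L).Provable
    ((φ →ₘ ψ) →ₘ ((φ →ₘ ¬ₘψ) →ₘ ¬ₘφ)) :=
  classical_provable_of_mem_axiomsCPC
    (φ := (Fm.p →ₘ Fm.q) →ₘ ((Fm.p →ₘ ¬ₘFm.q) →ₘ ¬ₘFm.p)) (by simp [axiomsCPC])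
    (substPQR φ ψ φ)

theorem classical_not_not (φ : Fm) : (classicalSystem L).Provable (¬ₘ¬ₘφ →ₘ φ) :=
  classical_provable_of_mem_axiomsCPC (φ := ¬ₘ¬ₘFm.p →ₘ Fm.p) (by simp [axiomsCPC])
    (substPQR φ φ φ)

theorem classical_id (φ : Fm) : (classicalSystem L).Provable (φ →ₘ φ) :=
  classical_mp (classical_mp (classical_s φ (φ →ₘ φ) φ) (classical_k φ _)) (classical_k φ φ)

theorem classical_comp {χ : Fm} (h : (classicalSystem L).Provable (φ →ₘ ψ))
    (h' : (classicalSystem L).Provable (ψ →ₘ χ)) : (classicalSystem L).Provable (φ →ₘ χ) :=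
  classical_mp (classical_mp (classical_s φ ψ χ) (classical_mp (classical_k _ φ) h')) h

theorem classical_con (h : (classicalSystem L).Provable (φ →ₘ ψ)) :
    (classicalSystem L).Provable (¬ₘψ →ₘ ¬ₘφ) :=
  classical_comp (classical_k (¬ₘψ) φ) (classical_mp (classical_neg_intro φ ψ) h)

theorem classical_em (φ : Fm) : (classicalSystem L).Provable (φ ∨ₘ ¬ₘφ) :=
  -- The negation of excluded middle implies both `¬ₘφ` and `¬ₘ¬ₘφ`.
  classical_mp (classical_not_not _)
    (classical_mp (classical_mp (classical_neg_intro _ (¬ₘφ))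
      (classical_con (classical_or_left φ (¬ₘφ))))
      (classical_con (classical_or_right φ (¬ₘφ))))

theorem classical_not_not_intro (φ : Fm) : (classicalSystem L).Provable (φ →ₘ ¬ₘ¬ₘφ) :=
  classical_comp (classical_k φ (¬ₘφ))
    (classical_mp (classical_mp (classical_s _ _ _) (classical_neg_intro (¬ₘφ) φ))
      (classical_mp (classical_k _ _) (classical_id (¬ₘφ))))

end Classical

/-! ### Transfer from `L` to `CL` -/

theorem classical_provable_of_mem_relevant_axioms {Λ : Set Postulate} {φ : Fm}
    (h : φ ∈ (relevantSystem Λ).axioms) :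
    (classicalSystem (relevantSystem Λ)).Provable φ := by
  have hp := Provable.ax h
  rcases h with h | h
  · simp only [systemBMC, Set.mem_insert_iff, Set.mem_singleton_iff] at h
    rcases h with rfl | rfl | rfl | rfl | rfl | rfl | rfl | rfl | rfl | rfl | rfl | rfl <;>
      exact classical_provable_imp hp
  · simp only [Set.mem_iUnion] at h
    obtain ⟨c, -, h⟩ := h
    cases c <;> simp only [Postulate.axioms, Set.mem_singleton_iff, Set.mem_empty_iff_false] at h <;>
      subst h
    -- The only axioms of `L` that are not implications.
    case DN => exact classical_and (classical_not_not_intro _) (classical_not_not _)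
    case X => exact classical_em _
    all_goals exact classical_provable_imp hp

theorem classical_provable_of_provable {Λ : Set Postulate}
    (hNec : Rule.nec ∉ (relevantSystem Λ).rules) {φ : Fm} (h : (relevantSystem Λ).Provable φ) :
    (classicalSystem (relevantSystem Λ)).Provable φ := by
  induction h with
  | ax h => exact classical_provable_of_mem_relevant_axioms h
  | rule hρ hi hΓ ih =>
    have hp := Provable.rule hρ hi hΓ
    rcases mem_relevantSystem_rules hρ with
      rfl | rfl | rfl | rfl | rfl | rfl | rfl | rfl | rfl
    · obtain ⟨τ, φ, hi⟩ := hi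
      cases hi
      exact (ih φ (by simp)).us us_mem_classicalSystem τ
    · obtain ⟨φ, ψ, hi⟩ := hi
      cases hi
      exact classical_mp (ih (φ →ₘ _) (by simp)) (ih φ (by simp))
    · obtain ⟨φ, ψ, hi⟩ := hi
      cases hi
      exact classical_and (ih φ (by simp)) (ih ψ (by simp))
    · obtain ⟨φ, φ', ψ, ψ', hi⟩ := hi
      cases hi
      exact classical_provable_imp hp
    · obtain ⟨φ, ψ, hi⟩ := hi
      cases hi
      exact classical_provable_imp hp
    · obtain ⟨φ, ψ, hi⟩ := hi
      cases hi
      exact classical_provable_imp hp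
    · obtain ⟨φ, ψ, hi⟩ := hi
      cases hi
      exact classical_provable_imp hp
    · obtain ⟨φ, ψ, hi⟩ := hi
      cases hi
      exact classical_provable_imp hp
    -- (Nec) concludes `□ₘφ`, which the Bridge Rule cannot reach.
    · exact absurd hρ hNec

theorem mainTheorem5 (Λ : Set Postulate)
    (hNec : Rule.nec ∉ (relevantSystem Λ).rules) (φ : Fm) :
    ((relevantSystem Λ).Provable φ →
      (classicalSystem (relevantSystem Λ)).Provable φ) ∧
    ((classicalSystem (relevantSystem Λ)).Provable (□ₗφ) →
      (classicalSystem (relevantSystem Λ)).Provable φ) :=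
  ⟨classical_provable_of_provable hNec, fun h =>
    classical_provable_of_provable hNec (provable_of_classical_provable_boxL h)⟩
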